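/- Let $K$ be a number field with ring of integers $\mathcal O_K$, let $n\ge 2$, let $f(x,y)=f_0x^n+f_1x^{n-1}y+\dots+f_ny^n$ be a binary $n$-ic form with coefficients in $\mathcal O_K$, and let $\mathfrak a$ be a nonzero ideal of $\mathcal O_K$. Let $R_f$ be the ring with underlying $\mathcal O_K$-module $\mathcal O_K^n$, with basis $\zeta_0=1,\zeta_1,\dots,\zeta_{n-1}$, and multiplication (Wood) $$\zeta_i\zeta_j=-\sum_{k=\max(i+j-n,1)}^{i} f_{i+j-k}\,\zeta_k+\sum_{k=j+1}^{\min(i+j,n)} f_{i+j-k}\,\zeta_k\qquad(1\le i\le j\le n-1),\qquad \zeta_n:=-f_n .$$ Let $R_f(\mathfrak a):=\mathcal O_K\zeta_0\oplus\dots\oplus\mathcal O_K\zeta_{n-2}\oplus\mathfrak a^{-1}\zeta_{n-1}\supseteq R_f$, an $\mathcal O_K$-submodule of $K^n$. (1) Suppose that $n\ge 3$, or that $n=2$ and $f_0$ is coprime to $\mathfrak a$ (for example $f_0=1$). Then the module $R_f(\mathfrak a)$ has a (commutative, unital) $\mathcal O_K$-algebra structure extending that of $R_f$ if and only if $f_{n-1}\in\mathfrak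 a$ and $f_n\in\mathfrak a^2$. (2) For every $n\ge 2$: if $f_{n-1}\in\mathfrak a$ and $f_n\in\mathfrak a^2$, then there is exactly one $\mathcal O_K$-algebra structure on $R_f(\mathfrak a)$ extending that of $R_f$; the Steinitz class of $R_f(\mathfrak a)$ is $[\mathfrak a^{-1}]$, that is, an ideal class $c$ satisfies $R_f(\mathfrak a)\simeq\mathcal O_K^{n-1}\oplus I$ as $\mathcal O_K$-modules for some fractional ideal $I$ of class $c$ if and only if $c=[\mathfrak a^{-1}]$; and, for this algebra structure, $\operatorname{Disc}(R_f(\mathfrak a))=\mathfrak a^{-2}\operatorname{Disc}(R_f)$, where the discriminant of a rank $n$ ring $R$ over $\mathcal O_K$ is the ideal generated by all $\det(\operatorname{Tr}(x_ix_j))_{1\le i,j\le n}$ with $x_1,\dots,x_n\in R$. -/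

import Mathlib

open scoped nonZeroDivisors TensorProduct NumberField

noncomputable section

namespace SteinitzRing

/-- A commutative, associative, unital `A`-algebra structure on the `A`-module `M` (inducing the
given module structure): a bilinear multiplication and a unit element. -/
@[ext]
structure AlgebraStructure (A M : Type*) [CommRing A] [AddCommGroup M] [Module A M] where
  mul : M →ₗ[A] M →ₗ[A] M
  one : M
  mul_comm : ∀ x y, mul x y = mul y x
  mul_assoc : ∀ x y z, mul (mul x y) z = mul x (mul y z)
  one_mul : ∀ x, mul one x = x

section Wood

variable {A : Type*} [CommRing A]

/-- The coefficient `f_m` of `x^(n-m) y^m` in the binary `n`-ic form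
`f = f_0 x^n + f_1 x^(n-1) y + ... + f_n y^n` (used for `m ≤ n` only). -/
def formCoeff (n : ℕ) (f : MvPolynomial (Fin 2) A) (m : ℕ) : A :=
  f.coeff (Finsupp.single 0 (n - m) + Finsupp.single 1 m)

/-- `u_1 = ... = u_{n-1} = 1` and `u_n = -f_n`. -/
def woodUnit (n : ℕ) (f : MvPolynomial (Fin 2) A) (k : ℕ) : A :=
  if k = n then -formCoeff n f n else 1

/-- The scalar giving the component `(A)_i ⊗ (A)_j → (A)_k` of the multiplication, for
`1 ≤ i ≤ j ≤ n - 1` and `1 ≤ k ≤ n`, where `(A)_n` means `(A)_0`. -/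
def woodTable (n : ℕ) (f : MvPolynomial (Fin 2) A) (i j k : ℕ) : A :=
  if max (i + j - n) 1 ≤ k ∧ k ≤ i then
    -(formCoeff n f (i + j - k) * woodUnit n f k)
  else if j < k ∧ k ≤ min (i + j) n then
    formCoeff n f (i + j - k) * woodUnit n f k
  else 0

/-- The structure constants of `R_f` on `A^n = (A)_0 ⊕ ... ⊕ (A)_{n-1}`: the generator of `(A)_0`
is the identity, the other products are given by `woodTable`, extended symmetrically in `i, j`. -/
def woodCoeff (n : ℕ) (f : MvPolynomial (Fin 2) A) (i j k : Fin n) : A :=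
  if i.val = 0 then (if j = k then 1 else 0)
  else if j.val = 0 then (if i = k then 1 else 0)
  else woodTable n f (min i.val j.val) (max i.val j.val) (if k.val = 0 then n else k.val)

/-- The multiplication of `R_f` on the module `A^n`. -/
def woodMul (n : ℕ) (f : MvPolynomial (Fin 2) A) :
    (Fin n → A) →ₗ[A] (Fin n → A) →ₗ[A] (Fin n → A) :=
  LinearMap.mk₂ A (fun x y k => ∑ i, ∑ j, x i * y j * woodCoeff n f i j k)
    (fun x x' y => by
      ext k; simp only [Pi.add_apply, add_mul, Finset.sum_add_distrib])
    (fun c x y => by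
      ext k; simp only [Pi.smul_apply, smul_eq_mul, Finset.mul_sum, mul_assoc])
    (fun x y y' => by
      ext k; simp only [Pi.add_apply, mul_add, add_mul, Finset.sum_add_distrib])
    (fun c x y => by
      ext k; simp only [Pi.smul_apply, smul_eq_mul, Finset.mul_sum, mul_assoc, mul_left_comm])

/-- The identity element of `R_f`, the element `1` of `(A)_0`. -/
def woodOne (A : Type*) [CommRing A] (n : ℕ) : Fin n → A :=
  fun i => if i.val = 0 then 1 else 0

end Wood

section Lattice

variable {A : Type*} [CommRing A] [IsDedekindDomain A]
  (K : Type*) [Field K] [Algebra A K] [IsFractionRing A K]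

/-- The invertible fractional ideal `𝔞⁻¹`. -/
def invIdeal (𝔞 : (Ideal A)⁰) : (FractionalIdeal A⁰ K)ˣ :=
  (FractionalIdeal.mk0 K 𝔞)⁻¹

/-- The module `R_f(𝔞) = (A)_0 ⊕ ... ⊕ (A)_{n-2} ⊕ 𝔞⁻¹ (A)_{n-1}`, inside `K^n`. -/
def extModule (n : ℕ) (𝔞 : (Ideal A)⁰) : Submodule A (Fin n → K) :=
  Submodule.pi Set.univ fun i =>
    if i.val + 1 = n then ((invIdeal K 𝔞 : FractionalIdeal A⁰ K) : Submodule A K)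
    else (1 : Submodule A K)

theorem algebraMap_mem_invIdeal (𝔞 : (Ideal A)⁰) (x : A) :
    algebraMap A K x ∈ ((invIdeal K 𝔞 : FractionalIdeal A⁰ K) : Submodule A K) := by
  have h0 : (FractionalIdeal.mk0 K 𝔞 : FractionalIdeal A⁰ K) ≠ 0 := Units.ne_zero _
  have h1 : (FractionalIdeal.mk0 K 𝔞 : FractionalIdeal A⁰ K) ≤ 1 := by
    simpa using FractionalIdeal.coeIdeal_le_one (S := A⁰) (P := K) (I := (𝔞 : Ideal A))
  rw [invIdeal, Units.val_inv_eq_inv_val, FractionalIdeal.mem_coe, FractionalIdeal.mem_inv_iff h0]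
  intro y hy
  obtain ⟨z, rfl⟩ := (FractionalIdeal.mem_one_iff A⁰).1 (h1 hy)
  exact (FractionalIdeal.mem_one_iff A⁰).2 ⟨x * z, by simp⟩

/-- The natural inclusion `R_f ⊆ R_f(𝔞)` of `A`-modules. -/
def incl (n : ℕ) (𝔞 : (Ideal A)⁰) : (Fin n → A) →ₗ[A] extModule K n 𝔞 :=
  LinearMap.codRestrict (extModule K n 𝔞) ((Algebra.linearMap A K).compLeft (Fin n)) <| by
    intro x i _
    dsimp only
    split_ifs
    · exact algebraMap_mem_invIdeal K 𝔞 (x i)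
    · exact Submodule.mem_one.2 ⟨x i, rfl⟩

variable {K} in
/-- The algebra structure `S` on `R_f(𝔞)` extends that of `R_f`. -/
def Extends {n : ℕ} {𝔞 : (Ideal A)⁰} (S : AlgebraStructure A (extModule K n 𝔞))
    (f : MvPolynomial (Fin 2) A) : Prop :=
  S.one = incl K n 𝔞 (woodOne A n) ∧
  ∀ x y : Fin n → A, S.mul (incl K n 𝔞 x) (incl K n 𝔞 y) = incl K n 𝔞 (woodMul n f x y)

/-- `c` is a Steinitz class of the rank `n` module `M`: one has `M ≃ A^{n-1} ⊕ I` for some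
invertible fractional ideal `I` of class `c`. -/
def IsSteinitzClass (n : ℕ) (M : Type*) [AddCommGroup M] [Module A M] (c : ClassGroup A) : Prop :=
  ∃ I : (FractionalIdeal A⁰ K)ˣ, ClassGroup.mk K I = c ∧
    Nonempty (M ≃ₗ[A] (Fin (n - 1) → A) × ((I : FractionalIdeal A⁰ K) : Submodule A K))

end Lattice

section Disc

variable {A : Type*} [CommRing A] (K : Type*) [Field K] [Algebra A K]
  {M : Type*} [AddCommGroup M] [Module A M]

/-- The trace form `(x, y) ↦ Tr(xy)` of a multiplication on `M`, where `Tr z` is the trace of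
multiplication by `z` on the `K`-vector space `K ⊗ M` (`M` itself need not be free). -/
def traceForm (mul : M →ₗ[A] M →ₗ[A] M) (x y : M) : K :=
  LinearMap.trace K (K ⊗[A] M) ((mul (mul x y)).baseChange K)

/-- The discriminant of a rank `n` algebra: the `A`-submodule of `K` generated by all
`det (Tr(x_i x_j))`, for `x_1, ..., x_n` in `M`. -/
def discIdeal (n : ℕ) (mul : M →ₗ[A] M →ₗ[A] M) : Submodule A K :=
  Submodule.span A
    (Set.range fun x : Fin n → M => (Matrix.of fun i j => traceForm K mul (x i) (x j)).det)

end Disc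

end SteinitzRing

end

/-! Everything takes place in `K^n` with the multiplication of `R_f ⊗ K`. Clearing denominators
shows that an algebra structure extending `R_f` must be the restriction of this one
(`Extends.coe_mul`). Hence it is unique, and it exists exactly when `R_f(𝔞)` is closed under the
product, which is a condition on structure constants: the coefficient of `ζ_k` in `ζ_i ζ_j` must lie
in the power of `𝔞` that offsets the factors `𝔞⁻¹` (`woodCoeff_mem`, `Extends.woodCoeff_mem`).

Associativity comes from realising `ζ_k` as `f_0 X^k + ... + f_(k-1) X` modulo `f(X, 1)`. The
realisation is faithful when `f_0 ≠ 0`, and a deformation of `f_0` covers the remaining case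
(`woodMul_assoc`).

The Steinitz class and the discriminant rest on one fact: the determinants of `n`-tuples in `A ⊕ ...
⊕ A ⊕ I` form exactly `I` (`det_mem_of_mem_lattice`, `exists_det_eq`). An isomorphism of two such
lattices scales determinants by a constant, so the ideals have the same class. Discriminants scale
by squares of determinants, and the squares of elements of `I` generate `I ^ 2` (`coe_sq_eq_span`).
-/

noncomputable section

namespace SteinitzRing

/-! ### Associativity of Wood's multiplication -/

section Associativity

open Polynomial

variable {A : Type*} [CommRing A]

/-- The polynomial `c_0 X^k + c_1 X^(k-1) + ... + c_(k-1) X`. -/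
def headPoly (c : ℕ → A) : ℕ → A[X]
  | 0 => 0
  | k + 1 => X * (headPoly c k + C (c k))

/-- Write `h_k` for `headPoly c k`. Then `h_i h_j` is the sum of `c_l X^(i-l) h_j`, and `X^(i-l)
h_j` is `h_(i+j-l)` without its last `i-l` terms; regrouping these by the coefficients `c_(j+m)`
gives the subtracted sum. Wood's rule is this identity reduced modulo `f(X, 1)`. -/
theorem headPoly_mul_headPoly (c : ℕ → A) (i j : ℕ) :
    headPoly c i * headPoly c j = ∑ l ∈ Finset.range i,
      (C (c l) * headPoly c (i + j - l) - C (c (j + l)) * headPoly c (i - l)) := by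
  induction i with
  | zero => simp [headPoly]
  | succ i ih =>
    -- The constants released by `h_(k+1) = X (h_k + c_k)` cancel under `l ↦ i - l`.
    have hrefl : ∑ l ∈ Finset.range (i + 1), C (c l) * C (c (i + j - l)) =
        ∑ l ∈ Finset.range (i + 1), C (c (j + l)) * C (c (i - l)) := by
      rw [← Finset.sum_range_reflect]
      refine Finset.sum_congr rfl fun l hl => ?_
      have hl := Finset.mem_range.1 hl
      rw [mul_comm]
      congr 3
      omega
    have hstep : ∀ l ∈ Finset.range i,
        C (c l) * headPoly c (i + 1 + j - l) - C (c (j + l)) * headPoly c (i + 1 - l) =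
          X * (C (c l) * headPoly c (i + j - l) - C (c (j + l)) * headPoly c (i - l)) +
          X * (C (c l) * C (c (i + j - l)) - C (c (j + l)) * C (c (i - l))) := by
      intro l hl
      have hl := Finset.mem_range.1 hl
      rw [show i + 1 + j - l = (i + j - l) + 1 by omega, show i + 1 - l = (i - l) + 1 by omega,
        headPoly, headPoly]
      ring
    rw [Finset.sum_range_succ, Finset.sum_congr rfl hstep, Finset.sum_add_distrib,
      ← Finset.mul_sum, ← Finset.mul_sum, ← ih, Finset.sum_sub_distrib]
    rw [Finset.sum_range_succ, Finset.sum_range_succ] at hrefl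
    rw [show i + 1 + j - i = j + 1 by omega, show i + 1 - i = 0 + 1 by omega]
    rw [show i + j - i = j by omega, show i - i = 0 by omega] at hrefl
    simp only [headPoly]
    linear_combination -X * hrefl

theorem natDegree_headPoly_le (c : ℕ → A) (k : ℕ) : (headPoly c k).natDegree ≤ k := by
  induction k with
  | zero => simp [headPoly]
  | succ k ih =>
    rw [headPoly]
    refine natDegree_mul_le.trans ?_
    have h1 := natDegree_X_le (R := A)
    have h2 : (headPoly c k + C (c k)).natDegree ≤ k := by
      rw [natDegree_add_C]; exact ih
    omega

theorem coeff_headPoly_self (c : ℕ → A) (k : ℕ) : (headPoly c (k + 1)).coeff (k + 1) = c 0 := by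
  induction k with
  | zero => simp [headPoly]
  | succ k ih => rw [headPoly, coeff_X_mul, coeff_add, ih]; simp

theorem degree_headPoly (c : ℕ → A) (hc : c 0 ≠ 0) (k : ℕ) :
    (headPoly c (k + 1)).degree = (k + 1 : ℕ) := by
  refine le_antisymm (degree_le_of_natDegree_le (natDegree_headPoly_le c _)) ?_
  exact le_degree_of_ne_zero (by rwa [coeff_headPoly_self])

/-- The polynomial `c_0 X^n + ... + c_n`. -/
def formPoly (n : ℕ) (c : ℕ → A) : A[X] := headPoly c n + C (c n)

/-- `h_(n+1)` is `X` times the form, and each later step only multiplies by `X`. -/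
theorem formPoly_dvd_headPoly {n : ℕ} {c : ℕ → A} (hc : ∀ m, n < m → c m = 0) (k : ℕ)
    (hk : n < k) : formPoly n c ∣ headPoly c k := by
  induction k, hk using Nat.le_induction with
  | base => exact Dvd.intro_left _ rfl
  | succ k hk ih =>
    rw [headPoly, hc k hk, C_0, add_zero]
    exact ih.mul_left _

/-- The basis `1, ζ_1, ζ_2, ...` as polynomials. -/
def zetaPoly (c : ℕ → A) (k : ℕ) : A[X] := if k = 0 then 1 else headPoly c k

/-- The map `R_f → A[X] / (f(X, 1))`. -/
def toQuotient (n : ℕ) (c : ℕ → A) : (Fin n → A) →ₗ[A] A[X] ⧸ Ideal.span {formPoly n c} :=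
  Fintype.linearCombination A fun k : Fin n =>
    Ideal.Quotient.mk (Ideal.span {formPoly n c}) (zetaPoly c k)

/-- The representatives have degrees `0, ..., n-1` and the form has degree `n`, so a combination
divisible by the form vanishes. Over a domain, `c 0` need not be a unit. -/
theorem toQuotient_injective [IsDomain A] {n : ℕ} (hn : n ≠ 0) {c : ℕ → A} (hc : c 0 ≠ 0) :
    Function.Injective (toQuotient n c) := by
  have hdeg : ∀ k, (zetaPoly c k).degree = k := by
    rintro (_ | k)
    · simp [zetaPoly]
    · rw [zetaPoly, if_neg k.succ_ne_zero, degree_headPoly c hc]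
  let S : Polynomial.Sequence A := ⟨zetaPoly c, hdeg⟩
  have hF : (formPoly n c).degree = n := by
    obtain ⟨m, rfl⟩ := Nat.exists_eq_succ_of_ne_zero hn
    rw [formPoly, degree_add_C (by rw [degree_headPoly c hc]; exact_mod_cast Nat.succ_pos m),
      degree_headPoly c hc]
  have hli : LinearIndependent A fun k : Fin n => zetaPoly c k :=
    S.linearIndependent.comp _ Fin.val_injective
  rw [← LinearMap.ker_eq_bot, LinearMap.ker_eq_bot']
  intro x hx
  rw [toQuotient, Fintype.linearCombination_apply] at hx
  have hx' : Ideal.Quotient.mk (Ideal.span {formPoly n c}) (∑ k : Fin n, x k • zetaPoly c k) = 0 := by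
    rw [← hx, map_sum]
    rfl
  rw [Ideal.Quotient.eq_zero_iff_mem, Ideal.mem_span_singleton] at hx'
  have hzero := eq_zero_of_dvd_of_degree_lt hx' (by
    rw [hF]
    refine (degree_sum_le _ _).trans_lt ((Finset.sup_lt_iff (WithBot.bot_lt_coe n)).2 ?_)
    intro k _
    refine (degree_smul_le _ _).trans_lt ?_
    rw [hdeg]
    exact Nat.cast_lt.2 k.2)
  ext k
  exact Fintype.linearIndependent_iff.1 hli x hzero k

/-- `woodTable` without the factors `woodUnit`. -/
def woodSign (n : ℕ) (c : ℕ → A) (i j k : ℕ) : A :=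
  if max (i + j - n) 1 ≤ k ∧ k ≤ i then -c (i + j - k)
  else if j < k ∧ k ≤ min (i + j) n then c (i + j - k)
  else 0

theorem woodTable_eq (n : ℕ) (f : MvPolynomial (Fin 2) A) (i j k : ℕ) :
    woodTable n f i j k = woodSign n (formCoeff n f) i j k * woodUnit n f k := by
  unfold woodTable woodSign
  split_ifs <;> ring

theorem sum_range_sub_eq {M : Type*} [AddCommMonoid M] (g : ℕ → M) (i j : ℕ) :
    ∑ l ∈ Finset.range i, g (i + j - l) = ∑ k ∈ Finset.Ioc j (i + j), g k := by
  refine Finset.sum_nbij' (fun l => i + j - l) (fun k => i + j - k) ?_ ?_ ?_ ?_ ?_ <;>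
    simp <;> intros <;> omega

/-- Wood's multiplication rule, modulo `f(X, 1)`. -/
theorem mk_headPoly_mul {n : ℕ} {c : ℕ → A} (hc : ∀ m, n < m → c m = 0) {i j : ℕ}
    (hij : i ≤ j) (hj : j < n) :
    Ideal.Quotient.mk (Ideal.span {formPoly n c}) (headPoly c i * headPoly c j) =
      ∑ k ∈ Finset.Ioc 0 n, woodSign n c i j k •
        Ideal.Quotient.mk (Ideal.span {formPoly n c}) (headPoly c k) := by
  set q : ℕ → A[X] ⧸ Ideal.span {formPoly n c} := fun k =>
    Ideal.Quotient.mk (Ideal.span {formPoly n c}) (headPoly c k) with hq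
  have hq0 : ∀ k, n < k → q k = 0 := fun k hk => by
    rw [hq]
    exact Ideal.Quotient.eq_zero_iff_mem.2
      (Ideal.mem_span_singleton.2 (formPoly_dvd_headPoly hc k hk))
  have hmk : ∀ (a : A) (k : ℕ), Ideal.Quotient.mk (Ideal.span {formPoly n c})
      (C a * headPoly c k) = a • q k := fun a k => by
    rw [← smul_eq_C_mul]; rfl
  rw [headPoly_mul_headPoly, map_sum]
  simp only [map_sub, hmk]
  rw [Finset.sum_sub_distrib]
  -- The cut at `k ≤ n` loses only classes `q k` that vanish.
  have h1 : ∑ l ∈ Finset.range i, c l • q (i + j - l) =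
      ∑ k ∈ Finset.Ioc 0 n, (if j < k ∧ k ≤ min (i + j) n then c (i + j - k) else 0) • q k := by
    have := sum_range_sub_eq (fun k => c (i + j - k) • q k) i j
    rw [Finset.sum_congr rfl (g := fun l => c (i + j - (i + j - l)) • q (i + j - l))
      (fun l hl => by
        have := Finset.mem_range.1 hl
        rw [show i + j - (i + j - l) = l by omega]), this]
    simp only [ite_smul, zero_smul]
    rw [← Finset.sum_filter]
    refine (Finset.sum_subset ?_ ?_).symm
    · intro k; simp; omega
    · intro k hk hk'
      have : n < k := by simp at hk hk'; omega
      rw [hq0 k this, smul_zero]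
  -- Here the bound `i + j - n ≤ k` drops only coefficients of index above `n`, which vanish.
  have h2 : ∑ l ∈ Finset.range i, c (j + l) • q (i - l) =
      ∑ k ∈ Finset.Ioc 0 n, (if max (i + j - n) 1 ≤ k ∧ k ≤ i then c (i + j - k) else 0) • q k := by
    have := sum_range_sub_eq (fun k => c (i + j - k) • q k) i 0
    rw [Finset.sum_congr rfl (g := fun l => c (i + j - (i + 0 - l)) • q (i + 0 - l))
      (fun l hl => by
        have := Finset.mem_range.1 hl
        rw [show i + j - (i + 0 - l) = j + l by omega, add_zero]), this]
    simp only [ite_smul, zero_smul]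
    rw [← Finset.sum_filter]
    refine (Finset.sum_subset ?_ ?_).symm
    · intro k; simp; omega
    · intro k hk hk'
      have : n < i + j - k := by simp at hk hk'; omega
      rw [hc _ this, zero_smul]
  rw [h1, h2, ← Finset.sum_sub_distrib]
  refine Finset.sum_congr rfl fun k _ => ?_
  rw [← sub_smul]
  congr 1
  unfold woodSign
  split_ifs <;> first | omega | simp

theorem woodCoeff_symm (n : ℕ) (f : MvPolynomial (Fin 2) A) (i j k : Fin n) :
    woodCoeff n f i j k = woodCoeff n f j i k := by
  unfold woodCoeff
  rw [min_comm, max_comm]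
  split_ifs <;> first | rfl | (exfalso; simp_all [Fin.ext_iff])

theorem formCoeff_eq_zero {n : ℕ} {f : MvPolynomial (Fin 2) A} (hf : f.IsHomogeneous n) (m : ℕ)
    (hm : n < m) : formCoeff n f m = 0 := by
  refine hf.coeff_eq_zero ?_
  simp [Finsupp.degree_eq_sum]
  omega

theorem mk_zetaPoly_mul {n : ℕ} {f : MvPolynomial (Fin 2) A} (hf : f.IsHomogeneous n)
    (i j : Fin n) :
    Ideal.Quotient.mk (Ideal.span {formPoly n (formCoeff n f)})
        (zetaPoly (formCoeff n f) i * zetaPoly (formCoeff n f) j) =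
      ∑ k, woodCoeff n f i j k • Ideal.Quotient.mk (Ideal.span {formPoly n (formCoeff n f)})
        (zetaPoly (formCoeff n f) k) := by
  wlog hij : i ≤ j generalizing i j
  · rw [mul_comm, this j i (le_of_not_ge hij)]
    simp only [woodCoeff_symm n f j i]
  by_cases hi : i.val = 0
  · simp [woodCoeff, hi, zetaPoly]
  have hij' : i.val ≤ j.val := hij
  have hj : j.val ≠ 0 := by omega
  have hF : Ideal.Quotient.mk (Ideal.span {formPoly n (formCoeff n f)})
      (headPoly (formCoeff n f) n) = woodUnit n f n • 1 := by
    have : Ideal.Quotient.mk (Ideal.span {formPoly n (formCoeff n f)})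
      (formPoly n (formCoeff n f)) = 0 := Ideal.Quotient.eq_zero_iff_mem.2
        (Ideal.mem_span_singleton_self _)
    conv at this => lhs; arg 2; rw [formPoly]
    rw [map_add] at this
    rw [eq_neg_of_add_eq_zero_left this, woodUnit, if_pos rfl, neg_smul,
      ← mul_one (C (formCoeff n f n)), ← smul_eq_C_mul]
    rfl
  have key := mk_headPoly_mul (formCoeff_eq_zero hf) hij' j.2
  rw [zetaPoly, zetaPoly, if_neg hi, if_neg hj, key]
  set Q := Ideal.Quotient.mk (Ideal.span {formPoly n (formCoeff n f)})
  simp only [woodCoeff, if_neg hi, if_neg hj, min_eq_left hij', max_eq_right hij', woodTable_eq]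
  set s := woodSign n (formCoeff n f) i j
  rw [Fin.sum_univ_eq_sum_range (fun k => (s (if k = 0 then n else k) *
    woodUnit n f (if k = 0 then n else k)) • Q (zetaPoly (formCoeff n f) k)) n]
  obtain ⟨m, rfl⟩ : ∃ m, n = m + 1 := ⟨n - 1, by omega⟩
  -- The slot `k = 0` on one side matches the index `n` on the other, because `ζ_n` is the scalar
  -- `-f_n`.
  rw [Finset.sum_range_succ', show Finset.Ioc 0 (m + 1) = (Finset.range (m + 1)).map
    ⟨Nat.succ, Nat.succ_injective⟩ by
      ext k; simp; constructor
      · intro h; exact ⟨k - 1, by omega, by omega⟩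
      · rintro ⟨a, h, rfl⟩; omega, Finset.sum_map, Finset.sum_range_succ]
  congr 1
  · refine Finset.sum_congr rfl fun k hk => ?_
    have := Finset.mem_range.1 hk
    simp [zetaPoly, woodUnit, this.ne]
  · simp only [Function.Embedding.coeFn_mk, Nat.succ_eq_add_one, if_true]
    rw [hF, smul_smul, zetaPoly, if_pos rfl, map_one]

theorem toQuotient_woodMul {n : ℕ} {f : MvPolynomial (Fin 2) A} (hf : f.IsHomogeneous n)
    (x y : Fin n → A) :
    toQuotient n (formCoeff n f) (woodMul n f x y) =
      toQuotient n (formCoeff n f) x * toQuotient n (formCoeff n f) y := by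
  simp only [toQuotient, Fintype.linearCombination_apply, Finset.sum_mul_sum, smul_mul_smul_comm,
    ← map_mul, mk_zetaPoly_mul hf, Finset.smul_sum, smul_smul]
  simp only [woodMul, LinearMap.mk₂_apply, Finset.sum_smul]
  rw [Finset.sum_comm]
  refine Finset.sum_congr rfl fun i _ => ?_
  rw [Finset.sum_comm]

theorem woodMul_assoc_of_ne_zero [IsDomain A] {n : ℕ} (hn : n ≠ 0) {f : MvPolynomial (Fin 2) A}
    (hf : f.IsHomogeneous n) (h0 : formCoeff n f 0 ≠ 0) (x y z : Fin n → A) :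
    woodMul n f (woodMul n f x y) z = woodMul n f x (woodMul n f y z) := by
  apply toQuotient_injective hn h0
  simp only [toQuotient_woodMul hf, mul_assoc]

theorem formCoeff_map {B : Type*} [CommRing B] (φ : A →+* B) (n : ℕ) (f : MvPolynomial (Fin 2) A)
    (m : ℕ) : formCoeff n (f.map φ) m = φ (formCoeff n f m) :=
  MvPolynomial.coeff_map _ _ _

theorem woodCoeff_map {B : Type*} [CommRing B] (φ : A →+* B) (n : ℕ) (f : MvPolynomial (Fin 2) A)
    (i j k : Fin n) : woodCoeff n (f.map φ) i j k = φ (woodCoeff n f i j k) := by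
  simp only [woodCoeff, woodTable, woodUnit, formCoeff_map, apply_ite φ, map_mul, map_neg,
    map_zero, map_one]

theorem woodMul_map {B : Type*} [CommRing B] (φ : A →+* B) (n : ℕ) (f : MvPolynomial (Fin 2) A)
    (x y : Fin n → A) :
    woodMul n (f.map φ) (fun i => φ (x i)) (fun i => φ (y i)) =
      fun i => φ (woodMul n f x y i) := by
  ext k
  simp [woodMul, woodCoeff_map]

theorem woodMul_comm (n : ℕ) (f : MvPolynomial (Fin 2) A) (x y : Fin n → A) :
    woodMul n f x y = woodMul n f y x := by
  ext k
  simp only [woodMul, LinearMap.mk₂_apply]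
  rw [Finset.sum_comm]
  refine Finset.sum_congr rfl fun i _ => Finset.sum_congr rfl fun j _ => ?_
  rw [woodCoeff_symm, mul_comm (x j)]

/-- Replacing `f_0` by `f_0 + X` over `A[X]` makes the leading coefficient nonzero; the structure
constants are compatible with ring maps, so setting `X = 0` returns the identity for `f`. -/
theorem woodMul_assoc [IsDomain A] {n : ℕ} (hn : n ≠ 0) {f : MvPolynomial (Fin 2) A}
    (hf : f.IsHomogeneous n) (x y z : Fin n → A) :
    woodMul n f (woodMul n f x y) z = woodMul n f x (woodMul n f y z) := by
  let g : MvPolynomial (Fin 2) A[X] := f.map C + MvPolynomial.monomial (Finsupp.single 0 n) X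
  have hg : g.IsHomogeneous n := (hf.map C).add
    (MvPolynomial.isHomogeneous_monomial _ (by simp))
  have hg0 : formCoeff n g 0 ≠ 0 := by
    have : formCoeff n g 0 = X + C (formCoeff n f 0) := by
      simp [g, formCoeff, MvPolynomial.coeff_map, MvPolynomial.coeff_monomial, add_comm]
    rw [this]
    exact X_add_C_ne_zero _
  have hgf : g.map (evalRingHom 0) = f := by
    simp only [g, map_add, MvPolynomial.map_map, MvPolynomial.map_monomial]
    have : (evalRingHom (0 : A)).comp C = RingHom.id A := by ext; simp
    rw [this]
    simp [MvPolynomial.map_id]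
  have key := woodMul_assoc_of_ne_zero hn hg hg0 (fun i => C (x i)) (fun i => C (y i))
    (fun i => C (z i))
  have hmap := woodMul_map (evalRingHom (0 : A)) n g
  rw [hgf] at hmap
  have := congrArg (fun (w : Fin n → A[X]) i => evalRingHom (0 : A) (w i)) key
  simp only [← hmap] at this
  simpa using this

theorem woodOne_mul (n : ℕ) (hn : n ≠ 0) (f : MvPolynomial (Fin 2) A) (x : Fin n → A) :
    woodMul n f (woodOne A n) x = x := by
  obtain ⟨m, rfl⟩ := Nat.exists_eq_succ_of_ne_zero hn
  ext k
  simp [woodMul, woodOne, Fin.sum_univ_succ, woodCoeff]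

end Associativity

/-! ### Existence and uniqueness of the extended multiplication -/

section Extension

theorem exists_smul_eq_algebraMap {A K : Type*} [CommRing A] [Field K] [Algebra A K] [IsFractionRing A K]
    {n : ℕ} (x : Fin n → K) :
    ∃ s ∈ A⁰, ∃ y : Fin n → A, s • x = fun i => algebraMap A K (y i) := by
  obtain ⟨s, hs⟩ := IsLocalization.exist_integer_multiples_of_finite A⁰ x
  choose y hy using hs
  exact ⟨s, s.2, y, funext fun i => (hy i).symm⟩

variable {A : Type*} [CommRing A] [IsDedekindDomain A]
  {K : Type*} [Field K] [Algebra A K] [IsFractionRing A K]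

/-- The exponent of `𝔞⁻¹` in the `i`-th summand of `R_f(𝔞)`. -/
def lastExp (n i : ℕ) : ℕ := if i + 1 = n then 1 else 0

theorem mem_extModule {n : ℕ} {𝔞 : (Ideal A)⁰} {x : Fin n → K} :
    x ∈ extModule K n 𝔞 ↔
      ∀ i : Fin n, x i ∈ (invIdeal K 𝔞 : FractionalIdeal A⁰ K) ^ lastExp n i := by
  simp only [extModule, Submodule.mem_pi, Set.mem_univ, true_imp_iff]
  refine forall_congr' fun i => ?_
  unfold lastExp
  split_ifs
  · rw [pow_one]; rfl
  · rw [pow_zero, Submodule.mem_one, FractionalIdeal.mem_one_iff]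

theorem one_le_invIdeal (𝔞 : (Ideal A)⁰) : 1 ≤ (invIdeal K 𝔞 : FractionalIdeal A⁰ K) := by
  rw [FractionalIdeal.one_le]
  simpa using algebraMap_mem_invIdeal K 𝔞 1

theorem coeIdeal_pow_mul_invIdeal_pow (𝔞 : (Ideal A)⁰) (m : ℕ) :
    (((𝔞 : Ideal A) ^ m : Ideal A) : FractionalIdeal A⁰ K) *
      (invIdeal K 𝔞 : FractionalIdeal A⁰ K) ^ m = 1 := by
  rw [FractionalIdeal.coeIdeal_pow, ← mul_pow, ← FractionalIdeal.coe_mk0, invIdeal,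
    Units.mul_inv, one_pow]

/-- The hypothesis says `c 𝔞^(-a-b) ⊆ 𝔞^(-d)`; multiply by `𝔞^(m+d)`. -/
theorem mem_pow_of_forall_mul_mul_mem {𝔞 : (Ideal A)⁰} {c : A} {m a b d : ℕ}
    (h : ∀ α ∈ (invIdeal K 𝔞 : FractionalIdeal A⁰ K) ^ a,
      ∀ β ∈ (invIdeal K 𝔞 : FractionalIdeal A⁰ K) ^ b,
        α * β * algebraMap A K c ∈ (invIdeal K 𝔞 : FractionalIdeal A⁰ K) ^ d)
    (hab : a + b = m + d) : c ∈ (𝔞 : Ideal A) ^ m := by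
  set I := (invIdeal K 𝔞 : FractionalIdeal A⁰ K)
  set J : ℕ → FractionalIdeal A⁰ K := fun r => (((𝔞 : Ideal A) ^ r : Ideal A) : FractionalIdeal A⁰ K)
  have hJ : ∀ r, J r * I ^ r = 1 := coeIdeal_pow_mul_invIdeal_pow 𝔞
  have h1 : I ^ a * (FractionalIdeal.spanSingleton A⁰ (algebraMap A K c) * I ^ b) ≤ I ^ d := by
    rw [FractionalIdeal.mul_le]
    intro i hi j hj
    obtain ⟨β, hβ, rfl⟩ := FractionalIdeal.mem_singleton_mul.1 hj
    rw [mul_left_comm, mul_comm]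
    exact h i hi β hβ
  have h2 := mul_le_mul_right h1 (J (m + d))
  have h3 : J (m + d) * (I ^ a * (FractionalIdeal.spanSingleton A⁰ (algebraMap A K c) * I ^ b)) =
      FractionalIdeal.spanSingleton A⁰ (algebraMap A K c) := by
    calc _ = (J (m + d) * I ^ (m + d)) * FractionalIdeal.spanSingleton A⁰ (algebraMap A K c) := by
          rw [← hab]; ring
      _ = _ := by rw [hJ, one_mul]
  have h4 : J (m + d) * I ^ d = J m := by
    calc _ = J m * (J d * I ^ d) := by
          simp only [J, pow_add, FractionalIdeal.coeIdeal_mul]; ring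
      _ = _ := by rw [hJ, mul_one]
  rw [h3, h4] at h2
  obtain ⟨c', hc', h⟩ := (FractionalIdeal.mem_coeIdeal A⁰).1
    (h2 (FractionalIdeal.mem_spanSingleton_self A⁰ _))
  rwa [← IsFractionRing.injective A K h]

theorem mul_mul_mem_invIdeal_pow {𝔞 : (Ideal A)⁰} {c : A} {m a b d : ℕ} {α β : K}
    (hc : c ∈ (𝔞 : Ideal A) ^ m) (hα : α ∈ (invIdeal K 𝔞 : FractionalIdeal A⁰ K) ^ a)
    (hβ : β ∈ (invIdeal K 𝔞 : FractionalIdeal A⁰ K) ^ b) (h : a + b ≤ m + d) :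
    α * β * algebraMap A K c ∈ (invIdeal K 𝔞 : FractionalIdeal A⁰ K) ^ d := by
  have h1 : α * β ∈ (invIdeal K 𝔞 : FractionalIdeal A⁰ K) ^ (m + d) := by
    refine pow_le_pow_right' (one_le_invIdeal (K := K) 𝔞) h ?_
    rw [pow_add]
    exact FractionalIdeal.mul_mem_mul hα hβ
  have h2 := FractionalIdeal.mul_mem_mul (FractionalIdeal.mem_coeIdeal_of_mem A⁰ hc (P := K)) h1
  rwa [pow_add, ← mul_assoc, coeIdeal_pow_mul_invIdeal_pow, one_mul, mul_comm] at h2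

/-- Only products with `ζ_(n-1)` impose a condition. Apart from multiplication by `1`, their
coefficients are multiples of `f_n`, except at `k = i`, where `f_(n-1)` appears and exponent at most
1 is required. Truncated subtraction is harmless: a negative exponent asks for nothing. -/
theorem woodCoeff_mem {A : Type*} [CommRing A] {n : ℕ} (hn : 2 ≤ n) {f : MvPolynomial (Fin 2) A} {𝔞 : Ideal A}
    (h1 : formCoeff n f (n - 1) ∈ 𝔞) (h2 : formCoeff n f n ∈ 𝔞 ^ 2) (i j k : Fin n) :
    woodCoeff n f i j k ∈ 𝔞 ^ (lastExp n i + lastExp n j - lastExp n k) := by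
  wlog hij : i ≤ j generalizing i j
  · rw [woodCoeff_symm, add_comm (lastExp n i)]
    exact this j i (le_of_not_ge hij)
  have hij' : i.val ≤ j.val := hij
  have hj := j.2
  have hk := k.2
  set m := lastExp n i + lastExp n j - lastExp n k with hm
  have hm2 : m ≤ 2 := by simp only [hm, lastExp]; split_ifs <;> omega
  by_cases hjn : j.val + 1 ≠ n
  · have hm0 : m = 0 := by
      have : i.val + 1 ≠ n := by omega
      simp [hm, lastExp, hjn, this]
    simp [hm0]
  replace hjn : j.val + 1 = n := not_not.1 hjn
  have hj0 : j.val ≠ 0 := by omega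
  have h2m : formCoeff n f n ∈ 𝔞 ^ m := Ideal.pow_le_pow_right hm2 h2
  unfold woodCoeff
  by_cases hi0 : i.val = 0
  · rw [if_pos hi0]
    split_ifs with hjk
    · have hm0 : m = 0 := by
        subst hjk
        have : i.val + 1 ≠ n := by omega
        simp [hm, lastExp, this]
      simp [hm0]
    · exact zero_mem _
  rw [if_neg hi0, if_neg hj0, min_eq_left hij', max_eq_right hij']
  generalize hk' : (if k.val = 0 then n else k.val) = k'
  unfold woodTable
  split_ifs with hlow hhigh
  · refine neg_mem (Ideal.mul_mem_right _ _ ?_)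
    obtain ⟨hl1, hl2⟩ := hlow
    have hkk : k.val = k' := by split_ifs at hk' <;> omega
    rcases (by omega : i.val + j.val - k' = n ∨ k' = i.val) with h | h
    · rwa [h]
    · have hm1 : m ≤ 1 := by
        simp only [hm, lastExp, hkk, h]
        split_ifs <;> omega
      rw [show i.val + j.val - k' = n - 1 by omega]
      exact Ideal.pow_le_pow_right hm1 (by rwa [pow_one])
  · refine Ideal.mul_mem_left _ _ ?_
    rw [woodUnit, if_pos (by omega)]
    exact neg_mem h2m
  · exact zero_mem _

theorem coe_incl {n : ℕ} {𝔞 : (Ideal A)⁰} (x : Fin n → A) :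
    (incl K n 𝔞 x : Fin n → K) = fun i => algebraMap A K (x i) := rfl

/-- The multiplication of an extension of `R_f` is that of `R_f ⊗ K`. -/
theorem Extends.coe_mul {n : ℕ} {𝔞 : (Ideal A)⁰} {S : AlgebraStructure A (extModule K n 𝔞)}
    {f : MvPolynomial (Fin 2) A} (h : Extends S f) (x y : extModule K n 𝔞) :
    (S.mul x y : Fin n → K) = woodMul n (f.map (algebraMap A K)) x y := by
  obtain ⟨s, hs, x', hx⟩ := exists_smul_eq_algebraMap (A := A) (x : Fin n → K)
  obtain ⟨t, ht, y', hy⟩ := exists_smul_eq_algebraMap (A := A) (y : Fin n → K)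
  have hx' : s • x = incl K n 𝔞 x' := Subtype.ext hx
  have hy' : t • y = incl K n 𝔞 y' := Subtype.ext hy
  have h1 : (s * t) • S.mul x y = incl K n 𝔞 (woodMul n f x' y') := by
    rw [← h.2, ← hx', ← hy', map_smul, map_smul, LinearMap.smul_apply, smul_smul, mul_comm]
  have h2 := congrArg (Subtype.val) h1
  rw [coe_incl, ← woodMul_map, ← hx, ← hy, LinearMap.map_smul_of_tower,
    LinearMap.map_smul_of_tower, LinearMap.smul_apply, smul_smul, mul_comm t s] at h2
  have hst : s * t ≠ 0 := mul_ne_zero (nonZeroDivisors.ne_zero hs) (nonZeroDivisors.ne_zero ht)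
  ext i
  have h3 := congrFun h2 i
  simp only [Submodule.coe_smul, Pi.smul_apply, Algebra.smul_def] at h3
  refine mul_left_cancel₀ ?_ h3
  simpa using hst

theorem woodMul_single {n : ℕ} {A : Type*} [CommRing A] (f : MvPolynomial (Fin 2) A) (i j k : Fin n)
    (a b : A) : woodMul n f (Pi.single i a) (Pi.single j b) k = a * b * woodCoeff n f i j k := by
  simp [woodMul, Pi.single_apply]

theorem woodMul_mem_extModule {n : ℕ} (hn : 2 ≤ n) {f : MvPolynomial (Fin 2) A} {𝔞 : (Ideal A)⁰}
    (h1 : formCoeff n f (n - 1) ∈ (𝔞 : Ideal A)) (h2 : formCoeff n f n ∈ (𝔞 : Ideal A) ^ 2)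
    {x y : Fin n → K} (hx : x ∈ extModule K n 𝔞) (hy : y ∈ extModule K n 𝔞) :
    woodMul n (f.map (algebraMap A K)) x y ∈ extModule K n 𝔞 := by
  rw [mem_extModule] at hx hy ⊢
  intro k
  simp only [woodMul, LinearMap.mk₂_apply, woodCoeff_map]
  refine Submodule.sum_mem (FractionalIdeal.coeToSubmodule _) fun i _ =>
    Submodule.sum_mem _ fun j _ => ?_
  exact mul_mul_mem_invIdeal_pow (woodCoeff_mem hn h1 h2 i j k) (hx i) (hy j) (by omega)

/-- The algebra structure of `R_f(𝔞)`, restricted from that of `R_f ⊗ K`. -/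
def extStructure {n : ℕ} (hn : 2 ≤ n) {f : MvPolynomial (Fin 2) A} (hf : f.IsHomogeneous n)
    {𝔞 : (Ideal A)⁰} (h1 : formCoeff n f (n - 1) ∈ (𝔞 : Ideal A))
    (h2 : formCoeff n f n ∈ (𝔞 : Ideal A) ^ 2) : AlgebraStructure A (extModule K n 𝔞) where
  mul := LinearMap.mk₂ A
    (fun x y => ⟨woodMul n (f.map (algebraMap A K)) x y, woodMul_mem_extModule hn h1 h2 x.2 y.2⟩)
    (fun x x' y => Subtype.ext <| by simp)
    (fun c x y => Subtype.ext <| by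
      simp only [Submodule.coe_smul, LinearMap.map_smul_of_tower, LinearMap.smul_apply])
    (fun x y y' => Subtype.ext <| by simp)
    (fun c x y => Subtype.ext <| by
      simp only [Submodule.coe_smul, LinearMap.map_smul_of_tower])
  one := incl K n 𝔞 (woodOne A n)
  mul_comm x y := Subtype.ext <| woodMul_comm _ _ _ _
  mul_assoc x y z := Subtype.ext <| woodMul_assoc (by omega) (hf.map _) _ _ _
  one_mul x := Subtype.ext <| by
    have : (incl K n 𝔞 (woodOne A n) : Fin n → K) = woodOne K n := by
      ext i; simp [coe_incl, woodOne, apply_ite (algebraMap A K)]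
    change woodMul n _ (incl K n 𝔞 (woodOne A n) : Fin n → K) x = x
    rw [this]
    exact woodOne_mul n (by omega) _ _

theorem extends_extStructure {n : ℕ} (hn : 2 ≤ n) {f : MvPolynomial (Fin 2) A}
    (hf : f.IsHomogeneous n) {𝔞 : (Ideal A)⁰} (h1 : formCoeff n f (n - 1) ∈ (𝔞 : Ideal A))
    (h2 : formCoeff n f n ∈ (𝔞 : Ideal A) ^ 2) :
    Extends (extStructure (K := K) hn hf h1 h2) f :=
  ⟨rfl, fun x y => Subtype.ext (woodMul_map (algebraMap A K) n f x y)⟩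

theorem Extends.unique {n : ℕ} {𝔞 : (Ideal A)⁰} {S T : AlgebraStructure A (extModule K n 𝔞)}
    {f : MvPolynomial (Fin 2) A} (hS : Extends S f) (hT : Extends T f) : S = T := by
  refine AlgebraStructure.ext ?_ (hS.1.trans hT.1.symm)
  ext x y : 2
  exact Subtype.ext ((hS.coe_mul x y).trans (hT.coe_mul x y).symm)

/-- Converse of `woodCoeff_mem`: the product is tested on vectors supported in a single summand. -/
theorem Extends.woodCoeff_mem {n : ℕ} {𝔞 : (Ideal A)⁰}
    {S : AlgebraStructure A (extModule K n 𝔞)} {f : MvPolynomial (Fin 2) A} (h : Extends S f)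
    (i j k : Fin n) {m : ℕ} (hm : lastExp n i + lastExp n j = m + lastExp n k) :
    woodCoeff n f i j k ∈ (𝔞 : Ideal A) ^ m := by
  have hsingle : ∀ (l : Fin n) (γ : K),
      γ ∈ (invIdeal K 𝔞 : FractionalIdeal A⁰ K) ^ lastExp n l →
        (Pi.single l γ : Fin n → K) ∈ extModule K n 𝔞 := by
    intro l γ hγ
    rw [mem_extModule]
    intro r
    by_cases hr : r = l
    · subst hr; simpa using hγ
    · rw [Pi.single_eq_of_ne hr]
      exact Submodule.zero_mem (FractionalIdeal.coeToSubmodule _)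
  refine mem_pow_of_forall_mul_mul_mem (K := K) (fun α hα β hβ => ?_) hm
  have := mem_extModule.1 (S.mul ⟨_, hsingle i α hα⟩ ⟨_, hsingle j β hβ⟩).2 k
  rwa [h.coe_mul, woodMul_single, woodCoeff_map] at this

/-- For `n ≥ 3`, `-f_(n-1)` is the `ζ_1`-coefficient of `ζ_1 ζ_(n-1)`, and `-f_n` is the
`ζ_(n-2)`-coefficient of `ζ_(n-1)^2`. For `n = 2` the latter slot is `ζ_0`, with coefficient `-f_0
f_2`, so `f_0` has to be cancelled modulo `𝔞^2`. -/
theorem Extends.coeff_mem {n : ℕ} (hn : 2 ≤ n) {𝔞 : (Ideal A)⁰}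
    {S : AlgebraStructure A (extModule K n 𝔞)} {f : MvPolynomial (Fin 2) A} (h : Extends S f)
    (h0 : n = 2 → IsCoprime (Ideal.span {formCoeff n f 0}) (𝔞 : Ideal A)) :
    formCoeff n f (n - 1) ∈ (𝔞 : Ideal A) ∧ formCoeff n f n ∈ (𝔞 : Ideal A) ^ 2 := by
  rcases hn.eq_or_lt with rfl | hn3
  · have h1 := h.woodCoeff_mem 1 1 1 (m := 1) (by simp [lastExp])
    have h2 := h.woodCoeff_mem 1 1 0 (m := 2) (by simp [lastExp])
    simp only [woodCoeff, woodTable, woodUnit] at h1 h2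
    norm_num at h1 h2
    refine ⟨h1, ?_⟩
    obtain ⟨u, hu, v, hv, huv⟩ := Ideal.isCoprime_iff_exists.1 ((h0 rfl).pow_right (n := 2))
    obtain ⟨w, rfl⟩ := Ideal.mem_span_singleton'.1 hu
    rw [← mul_one (formCoeff 2 f 2), ← huv, mul_add]
    refine add_mem ?_ (Ideal.mul_mem_left _ _ hv)
    have := Ideal.mul_mem_left _ w h2
    convert this using 1
    ring
  · let L : Fin n := ⟨n - 1, by omega⟩
    have h1 := h.woodCoeff_mem ⟨1, by omega⟩ L ⟨1, by omega⟩ (m := 1) (by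
      simp only [lastExp, L]; split_ifs <;> omega)
    have h2 := h.woodCoeff_mem L L ⟨n - 2, by omega⟩ (m := 2) (by
      simp only [lastExp, L]; split_ifs <;> omega)
    have e1 : woodCoeff n f ⟨1, by omega⟩ L ⟨1, by omega⟩ = -formCoeff n f (n - 1) := by
      have a1 : n - 1 ≠ 0 := by omega
      have a2 : min 1 (n - 1) = 1 := by omega
      have a3 : max 1 (n - 1) = n - 1 := by omega
      have a4 : max (1 + (n - 1) - n) 1 ≤ 1 := by omega
      have a5 : 1 ≠ n := by omega
      have a6 : 1 + (n - 1) - 1 = n - 1 := by omega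
      simp only [woodCoeff, L, a1, a2, a3, woodTable, woodUnit, one_ne_zero, if_false]
      rw [if_pos ⟨a4, le_rfl⟩, if_neg a5, a6, mul_one]
    have e2 : woodCoeff n f L L ⟨n - 2, by omega⟩ = -formCoeff n f n := by
      have a1 : n - 1 ≠ 0 := by omega
      have a2 : n - 2 ≠ 0 := by omega
      have a4 : max (n - 1 + (n - 1) - n) 1 ≤ n - 2 ∧ n - 2 ≤ n - 1 := by omega
      have a5 : n - 2 ≠ n := by omega
      have a6 : n - 1 + (n - 1) - (n - 2) = n := by omega
      simp only [woodCoeff, L, a1, a2, min_self, max_self, woodTable, woodUnit, a5, a6,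
        if_false]
      rw [if_pos a4, mul_one]
    rw [e1, neg_mem_iff, pow_one] at h1
    rw [e2, neg_mem_iff] at h2
    exact ⟨h1, h2⟩

end Extension

/-! ### Determinants of tuples of lattice vectors -/

section Determinants

variable {A : Type*} [CommRing A] {K : Type*} [Field K] [Algebra A K]

/-- The lattice `A ⊕ ... ⊕ A ⊕ I` in `K^n`. -/
def lattice (n : ℕ) (I : FractionalIdeal A⁰ K) : Submodule A (Fin n → K) :=
  Submodule.pi Set.univ fun i => ((I ^ lastExp n i : FractionalIdeal A⁰ K) : Submodule A K)

theorem mem_lattice {n : ℕ} {I : FractionalIdeal A⁰ K} {x : Fin n → K} :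
    x ∈ lattice n I ↔ ∀ i : Fin n, x i ∈ I ^ lastExp n i := by
  simp only [lattice, Submodule.mem_pi, Set.mem_univ, true_imp_iff, FractionalIdeal.mem_coe]

theorem prod_mem_pow_sum {ι : Type*} (I : FractionalIdeal A⁰ K) (s : Finset ι) (x : ι → K)
    (e : ι → ℕ) (h : ∀ i ∈ s, x i ∈ I ^ e i) : ∏ i ∈ s, x i ∈ I ^ ∑ i ∈ s, e i := by
  classical
  induction s using Finset.induction_on with
  | empty => simpa using ⟨1, map_one _⟩
  | insert a s ha ih =>
    rw [Finset.prod_insert ha, Finset.sum_insert ha, pow_add]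
    exact FractionalIdeal.mul_mem_mul (h a (Finset.mem_insert_self a s))
      (ih fun i hi => h i (Finset.mem_insert_of_mem hi))

theorem sum_lastExp {n : ℕ} (hn : n ≠ 0) : ∑ i : Fin n, lastExp n i = 1 := by
  obtain ⟨m, rfl⟩ := Nat.exists_eq_succ_of_ne_zero hn
  rw [Fin.sum_univ_castSucc, Finset.sum_eq_zero fun i _ => ?_]
  · simp [lastExp]
  · simp [lastExp, i.2.ne]

/-- Each Leibniz term takes exactly one entry from the last column. -/
theorem det_mem_of_mem_lattice {n : ℕ} (hn : n ≠ 0) {I : FractionalIdeal A⁰ K}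
    {X : Matrix (Fin n) (Fin n) K} (hX : ∀ i, X i ∈ lattice n I) : X.det ∈ I := by
  rw [Matrix.det_apply]
  refine Submodule.sum_mem I.coeToSubmodule fun σ _ => ?_
  rw [Units.smul_def]
  refine zsmul_mem (S := Submodule A K) ?_ _
  have := prod_mem_pow_sum I Finset.univ (fun i => X (σ i) i) (fun i : Fin n => lastExp n i)
    fun i _ => mem_lattice.1 (hX (σ i)) i
  rwa [sum_lastExp hn, pow_one] at this

/-- The witness is the diagonal matrix `(1, ..., 1, a)`. -/
theorem exists_det_eq {n : ℕ} (hn : n ≠ 0) {I : FractionalIdeal A⁰ K} {a : K} (ha : a ∈ I) :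
    ∃ X : Matrix (Fin n) (Fin n) K, (∀ i, X i ∈ lattice n I) ∧ X.det = a := by
  refine ⟨Matrix.diagonal fun i => a ^ lastExp n i, fun i => mem_lattice.2 fun j => ?_, ?_⟩
  · rw [Matrix.diagonal_apply]
    split_ifs with hij
    · subst hij
      unfold lastExp
      split_ifs
      · simpa using ha
      · simpa using ⟨1, map_one _⟩
    · exact Submodule.zero_mem (FractionalIdeal.coeToSubmodule _)
  · rw [Matrix.det_diagonal, Finset.prod_pow_eq_pow_sum, sum_lastExp hn, pow_one]

end Determinants

/-! ### The Steinitz class -/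

section Steinitz

variable {A : Type*} [CommRing A] {K : Type*} [Field K] [Algebra A K]

/-- The coordinates `A^m ⊕ I → K^(m+1)`. -/
def snocMap (m : ℕ) (I : FractionalIdeal A⁰ K) :
    ((Fin m → A) × (I : Submodule A K)) →ₗ[A] (Fin (m + 1) → K) where
  toFun p := Fin.snoc (α := fun _ => K) (fun i => algebraMap A K (p.1 i)) (p.2 : K)
  map_add' p q := by
    ext i
    refine Fin.lastCases ?_ (fun i => ?_) i <;> simp
  map_smul' c p := by
    ext i
    refine Fin.lastCases ?_ (fun i => ?_) i <;> simp [Algebra.smul_def]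

theorem snocMap_injective [IsFractionRing A K] (m : ℕ) (I : FractionalIdeal A⁰ K) :
    Function.Injective (snocMap m I) := by
  intro p q h
  refine Prod.ext (funext fun i => ?_) (Subtype.ext ?_)
  · have := congrFun h i.castSucc
    simp only [snocMap, LinearMap.coe_mk, AddHom.coe_mk, Fin.snoc_castSucc] at this
    exact IsFractionRing.injective A K this
  · have := congrFun h (Fin.last m)
    simpa only [snocMap, LinearMap.coe_mk, AddHom.coe_mk, Fin.snoc_last] using this

theorem range_snocMap (m : ℕ) (I : FractionalIdeal A⁰ K) :
    LinearMap.range (snocMap m I) = lattice (m + 1) I := by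
  ext x
  rw [mem_lattice]
  constructor
  · rintro ⟨p, rfl⟩ i
    refine Fin.lastCases ?_ (fun i => ?_) i
    · simp [snocMap, lastExp]
    · simp only [snocMap, LinearMap.coe_mk, AddHom.coe_mk, Fin.snoc_castSucc, lastExp,
        Fin.val_castSucc, Nat.add_right_cancel_iff, i.2.ne, if_false, pow_zero]
      exact (FractionalIdeal.mem_one_iff A⁰).2 ⟨_, rfl⟩
  · intro h
    have h1 : ∀ i : Fin m, ∃ a : A, algebraMap A K a = x i.castSucc := fun i => by
      have := h i.castSucc
      simp only [lastExp, Fin.val_castSucc, Nat.add_right_cancel_iff, i.2.ne, if_false,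
        pow_zero] at this
      exact (FractionalIdeal.mem_one_iff A⁰).1 this
    have h2 : x (Fin.last m) ∈ I := by simpa [lastExp] using h (Fin.last m)
    choose a ha using h1
    refine ⟨(a, ⟨_, h2⟩), ?_⟩
    ext i
    refine Fin.lastCases ?_ (fun i => ?_) i
    · simp [snocMap]
    · simp [snocMap, ha]

variable [IsDedekindDomain A] [IsFractionRing A K]

theorem extModule_eq_lattice (n : ℕ) (𝔞 : (Ideal A)⁰) :
    extModule K n 𝔞 = lattice n (invIdeal K 𝔞 : FractionalIdeal A⁰ K) := by
  ext x
  rw [mem_extModule, mem_lattice]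

theorem isSteinitzClass_invIdeal {n : ℕ} (hn : n ≠ 0) (𝔞 : (Ideal A)⁰) :
    IsSteinitzClass K n (extModule K n 𝔞) (ClassGroup.mk K (invIdeal K 𝔞)) := by
  obtain ⟨m, rfl⟩ := Nat.exists_eq_succ_of_ne_zero hn
  refine ⟨invIdeal K 𝔞, rfl, ⟨?_⟩⟩
  refine (LinearEquiv.ofEq _ _ ?_).trans
    (LinearEquiv.ofInjective _ (snocMap_injective m (invIdeal K 𝔞 : FractionalIdeal A⁰ K))).symm
  rw [range_snocMap, extModule_eq_lattice]

/-- A linear map from `R_f(𝔞)` to a `K`-vector space is given by a matrix. -/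
theorem exists_matrix_of_linearMap {n : ℕ} {𝔞 : (Ideal A)⁰}
    (φ : extModule K n 𝔞 →ₗ[A] (Fin n → K)) :
    ∃ T : Matrix (Fin n) (Fin n) K, ∀ x, φ x = Matrix.vecMul (x : Fin n → K) T := by
  refine ⟨Matrix.of fun i => φ (incl K n 𝔞 fun j => if i = j then 1 else 0), fun x => ?_⟩
  obtain ⟨s, hs, y, hy⟩ := exists_smul_eq_algebraMap (A := A) (x : Fin n → K)
  have hy' : s • x = incl K n 𝔞 y := Subtype.ext hy
  have h1 := LinearMap.pi_apply_eq_sum_univ (φ ∘ₗ incl K n 𝔞) y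
  rw [LinearMap.comp_apply, ← hy', map_smul] at h1
  have hs0 : algebraMap A K s ≠ 0 := by simpa using nonZeroDivisors.ne_zero hs
  ext k
  refine mul_left_cancel₀ hs0 ?_
  have h2 := congrFun h1 k
  rw [Pi.smul_apply, Algebra.smul_def] at h2
  rw [h2, Matrix.vecMul, dotProduct, Finset.mul_sum, Finset.sum_apply]
  refine Finset.sum_congr rfl fun i _ => ?_
  have h3 := congrFun hy i
  rw [Pi.smul_apply, Algebra.smul_def] at h3
  rw [Pi.smul_apply, Algebra.smul_def, ← h3, mul_assoc]
  rfl

/-- An isomorphism onto `A^(n-1) ⊕ I` is right multiplication by a matrix `T` over `K`. Comparing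
determinants of tuples on both sides gives `I = det T · 𝔞⁻¹`. -/
theorem isSteinitzClass_extModule_iff {n : ℕ} (hn : n ≠ 0) (𝔞 : (Ideal A)⁰) (c : ClassGroup A) :
    IsSteinitzClass K n (extModule K n 𝔞) c ↔ c = ClassGroup.mk K (invIdeal K 𝔞) := by
  refine ⟨?_, fun h => h ▸ isSteinitzClass_invIdeal hn 𝔞⟩
  rintro ⟨I, rfl, ⟨e⟩⟩
  have hn0 := hn
  obtain ⟨m, rfl⟩ := Nat.exists_eq_succ_of_ne_zero hn
  let φ : extModule K (m + 1) 𝔞 →ₗ[A] (Fin (m + 1) → K) :=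
    snocMap m (I : FractionalIdeal A⁰ K) ∘ₗ e.toLinearMap
  have hφ : LinearMap.range φ = lattice (m + 1) (I : FractionalIdeal A⁰ K) := by
    rw [LinearMap.range_comp, LinearEquiv.range, Submodule.map_top, range_snocMap]
  obtain ⟨T, hT⟩ := exists_matrix_of_linearMap φ
  have key : (I : FractionalIdeal A⁰ K) =
      FractionalIdeal.spanSingleton A⁰ T.det * (invIdeal K 𝔞 : FractionalIdeal A⁰ K) := by
    refine le_antisymm ?_ ?_
    · intro α hα
      obtain ⟨X, hX, rfl⟩ := exists_det_eq hn0 hα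
      have : ∀ i, ∃ y, φ y = X i := fun i => by
        have := hX i
        rwa [← hφ] at this
      choose y hy using this
      have hXY : X = Matrix.of (fun i => (y i : Fin (m + 1) → K)) * T := by
        ext i j
        rw [← hy i, hT]
        rfl
      rw [hXY, Matrix.det_mul, mul_comm (Matrix.det _)]
      refine FractionalIdeal.mul_mem_mul (FractionalIdeal.mem_spanSingleton_self _ _)
        (det_mem_of_mem_lattice hn0 fun i => ?_)
      rw [← extModule_eq_lattice]
      exact (y i).2
    · rw [FractionalIdeal.mul_le]
      intro a ha α hα
      obtain ⟨z, rfl⟩ := (FractionalIdeal.mem_spanSingleton A⁰).1 ha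
      obtain ⟨Y, hY, rfl⟩ := exists_det_eq hn0 hα
      rw [smul_mul_assoc, mul_comm, ← Matrix.det_mul]
      refine Submodule.smul_mem (I : FractionalIdeal A⁰ K).coeToSubmodule z
        (det_mem_of_mem_lattice hn0 fun i => ?_)
      rw [← extModule_eq_lattice] at hY
      rw [← hφ]
      exact ⟨⟨Y i, hY i⟩, hT _⟩
  rw [← mul_inv_eq_one, ← map_inv, ← map_mul, ClassGroup.mk_eq_one_iff]
  rw [Units.val_mul, key, mul_assoc, Units.mul_inv, mul_one, FractionalIdeal.coe_spanSingleton]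
  exact ⟨_, rfl⟩

end Steinitz

/-! ### The discriminant -/

section Discriminant

variable {A : Type*} [CommRing A] {K : Type*} [Field K] [Algebra A K]

/-- Moves the traces on `K ⊗ M` to `K^n`, through the isomorphism induced by `g`. -/
theorem trace_baseChange_eq {M V : Type*} [AddCommGroup M] [Module A M] [AddCommGroup V]
    [Module A V] [Module K V] [IsScalarTower A K V] {g : M →ₗ[A] V} (hg : IsBaseChange K g)
    (L : M →ₗ[A] M) (T : V →ₗ[K] V) (h : ∀ x, T (g x) = g (L x)) :
    LinearMap.trace K (K ⊗[A] M) (L.baseChange K) = LinearMap.trace K V T := by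
  rw [← LinearMap.trace_conj' _ hg.equiv]
  congr 1
  ext v
  obtain ⟨z, rfl⟩ := hg.equiv.surjective v
  rw [LinearEquiv.conj_apply_apply, LinearEquiv.symm_apply_apply]
  induction z with
  | zero => simp
  | tmul k x => simp [IsBaseChange.equiv_tmul, h]
  | add y z hy hz => simp only [map_add, hy, hz]

theorem isBaseChange_of_injective [IsFractionRing A K] {M : Type*} [AddCommGroup M]
    [Module A M] {n : ℕ} (g : M →ₗ[A] (Fin n → K)) (hg : Function.Injective g)
    (hr : ∀ y : Fin n → A, ∃ x, g x = fun i => algebraMap A K (y i)) : IsBaseChange K g := by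
  rw [← isLocalizedModule_iff_isBaseChange A⁰]
  refine ⟨fun s => ?_, fun y => ?_, fun h => ⟨1, by rw [hg h]⟩⟩
  · rw [← (Algebra.lsmul A (A := K) A (Fin n → K)).commutes]
    exact (IsLocalization.map_units K s).map _
  · obtain ⟨s, hs, z, hz⟩ := exists_smul_eq_algebraMap (A := A) y
    obtain ⟨x, hx⟩ := hr z
    exact ⟨(x, ⟨s, hs⟩), hz.trans hx.symm⟩

/-- The trace form `(x, y) ↦ Tr(xy)` of a multiplication on a vector space. -/
def traceBilin {V : Type*} [AddCommGroup V] [Module K V] (B : V →ₗ[K] V →ₗ[K] V) :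
    V →ₗ[K] V →ₗ[K] K :=
  B.compr₂ (LinearMap.trace K V ∘ₗ B)

/-- The Gram matrix of a tuple with coordinate matrix `X` is `X G Xᵀ`, where `G` is the Gram matrix
of the standard basis. -/
theorem discIdeal_eq_span {M : Type*} [AddCommGroup M] [Module A M] {n : ℕ}
    {mul : M →ₗ[A] M →ₗ[A] M} {B : (Fin n → K) →ₗ[K] (Fin n → K) →ₗ[K] (Fin n → K)}
    {g : M →ₗ[A] (Fin n → K)} (hg : IsBaseChange K g)
    (h : ∀ x y, g (mul x y) = B (g x) (g y)) :
    discIdeal K n mul = Submodule.span A (Set.range fun x : Fin n → M =>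
      (Matrix.of fun i => g (x i)).det ^ 2 *
        (LinearMap.BilinForm.toMatrix' (traceBilin B)).det) := by
  unfold discIdeal
  congr 2
  ext x
  have ht : ∀ u v, traceForm K mul u v = traceBilin B (g u) (g v) := fun u v => by
    rw [traceForm, trace_baseChange_eq hg _ (B (g (mul u v))) fun w => (h _ w).symm, h]
    rfl
  set G := LinearMap.BilinForm.toMatrix' (traceBilin B) with hG
  have hX : (Matrix.of fun i j => traceForm K mul (x i) (x j)) =
      (Matrix.of fun i => g (x i)) * G * (Matrix.of fun i => g (x i)).transpose := by
    ext i j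
    rw [Matrix.mul_mul_apply, ← Matrix.toBilin'_apply', hG, Matrix.toBilin'_toMatrix']
    exact ht _ _
  rw [hX, Matrix.det_mul, Matrix.det_mul, Matrix.det_transpose]
  ring

theorem discIdeal_woodMul [IsFractionRing A K] (n : ℕ)
    (f : MvPolynomial (Fin 2) A) :
    discIdeal K n (woodMul n f) = Submodule.span A {(LinearMap.BilinForm.toMatrix'
      (traceBilin (woodMul n (f.map (algebraMap A K))))).det} := by
  let g : (Fin n → A) →ₗ[A] (Fin n → K) := (Algebra.linearMap A K).compLeft (Fin n)
  have hg : IsBaseChange K g := isBaseChange_of_injective g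
    (fun x y h => funext fun i => IsFractionRing.injective A K (congrFun h i)) fun y => ⟨y, rfl⟩
  rw [discIdeal_eq_span hg fun x y => (woodMul_map (algebraMap A K) n f x y).symm]
  refine le_antisymm (Submodule.span_le.2 ?_) (Submodule.span_le.2 ?_)
  · rintro _ ⟨x, rfl⟩
    refine Submodule.mem_span_singleton.2 ⟨(Matrix.of x).det ^ 2, ?_⟩
    rw [Algebra.smul_def, map_pow, RingHom.map_det]
    rfl
  · rintro _ rfl
    refine Submodule.subset_span ⟨fun i => Pi.single i 1, ?_⟩
    have : (Matrix.of fun i => g (Pi.single i 1)) = (1 : Matrix (Fin n) (Fin n) K) := by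
      ext i j
      simp [g, Matrix.one_apply, Pi.single_apply, eq_comm]
    simp [this]

variable [IsDedekindDomain A] [IsFractionRing A K]

/-- One has `(a, b)(a², b², ab) = (a, b)(a², b²)`, and the nonzero ideal `(a, b)` cancels in a
Dedekind domain. -/
theorem mul_mem_span_sq (a b : K) : a * b ∈ Submodule.span A {a ^ 2, b ^ 2} := by
  by_cases ha : a = 0
  · simp [ha]
  let s : K → FractionalIdeal A⁰ K := FractionalIdeal.spanSingleton A⁰
  have hmul : ∀ x y, s x * s y = s (x * y) := FractionalIdeal.spanSingleton_mul_spanSingleton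
  have hJ : s a + s b ≠ 0 := by
    intro h
    have : a ∈ s a + s b := (le_sup_left : s a ≤ s a ⊔ s b)
      (FractionalIdeal.mem_spanSingleton_self A⁰ a)
    rw [h] at this
    exact ha ((FractionalIdeal.mem_zero_iff A⁰).1 this)
  have idem : ∀ I : FractionalIdeal A⁰ K, I + I = I := fun I => sup_idem I
  have h1 : (s a + s b) * (s a ^ 2 + s b ^ 2 + s a * s b) = (s a + s b) * (s a ^ 2 + s b ^ 2) := by
    calc _ = s a ^ 3 + s b ^ 3 + (s a * s b ^ 2 + s a * s b ^ 2) +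
          (s a ^ 2 * s b + s a ^ 2 * s b) := by ring
      _ = s a ^ 3 + s b ^ 3 + s a * s b ^ 2 + s a ^ 2 * s b := by rw [idem, idem]
      _ = _ := by ring
  have h2 := mul_left_cancel₀ hJ h1
  have h3 : a * b ∈ s a ^ 2 + s b ^ 2 := by
    rw [← h2]
    refine (le_sup_right : s a * s b ≤ _ ⊔ s a * s b) ?_
    rw [hmul]
    exact FractionalIdeal.mem_spanSingleton_self A⁰ _
  rw [sq, sq, hmul, hmul, ← FractionalIdeal.mem_coe, FractionalIdeal.coe_add,
    FractionalIdeal.coe_spanSingleton, FractionalIdeal.coe_spanSingleton, Submodule.add_eq_sup,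
    ← Submodule.span_union] at h3
  simpa [sq, Set.pair_comm] using h3

/-- Needed because the discriminant ideal supplies squares of single determinants only, not products
of two different ones. -/
theorem coe_sq_eq_span (I : FractionalIdeal A⁰ K) :
    ((I ^ 2 : FractionalIdeal A⁰ K) : Submodule A K) =
      Submodule.span A ((fun a => a ^ 2) '' (I : Set K)) := by
  refine le_antisymm ?_ ?_
  · rw [sq, FractionalIdeal.coe_mul, Submodule.mul_le]
    intro a ha b hb
    refine Submodule.span_mono ?_ (mul_mem_span_sq a b)
    rintro _ (rfl | rfl)
    · exact ⟨a, ha, rfl⟩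
    · exact ⟨b, hb, rfl⟩
  · rw [Submodule.span_le]
    rintro _ ⟨a, ha, rfl⟩
    simp only [sq]
    exact FractionalIdeal.mul_mem_mul ha ha

theorem Extends.discIdeal_eq {n : ℕ} (hn : n ≠ 0) {𝔞 : (Ideal A)⁰}
    {S : AlgebraStructure A (extModule K n 𝔞)} {f : MvPolynomial (Fin 2) A} (h : Extends S f) :
    discIdeal K n S.mul =
      (((invIdeal K 𝔞 : FractionalIdeal A⁰ K) ^ 2 : FractionalIdeal A⁰ K) : Submodule A K) *
        discIdeal K n (woodMul n f) := by
  have hg : IsBaseChange K (extModule K n 𝔞).subtype :=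
    isBaseChange_of_injective _ Subtype.val_injective fun y => ⟨incl K n 𝔞 y, rfl⟩
  rw [discIdeal_eq_span hg h.coe_mul, discIdeal_woodMul, coe_sq_eq_span, Submodule.span_mul_span,
    Set.mul_singleton, Set.image_image]
  congr 1
  ext d
  constructor
  · rintro ⟨x, rfl⟩
    refine ⟨_, det_mem_of_mem_lattice hn fun i => ?_, rfl⟩
    rw [← extModule_eq_lattice]
    exact (x i).2
  · rintro ⟨a, ha, rfl⟩
    obtain ⟨X, hX, rfl⟩ := exists_det_eq hn ha
    rw [← extModule_eq_lattice] at hX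
    exact ⟨fun i => ⟨X i, hX i⟩, rfl⟩

end Discriminant

end SteinitzRing

end

theorem mainTheorem3 (K : Type*) [Field K] [NumberField K] (n : ℕ) (hn : 2 ≤ n)
    (f : MvPolynomial (Fin 2) (𝓞 K)) (hf : f.IsHomogeneous n) (𝔞 : (Ideal (𝓞 K))⁰) :
    ((n = 2 → IsCoprime (Ideal.span {SteinitzRing.formCoeff n f 0}) (𝔞 : Ideal (𝓞 K))) →
      ((∃ S : SteinitzRing.AlgebraStructure (𝓞 K) (SteinitzRing.extModule K n 𝔞),
          SteinitzRing.Extends S f) ↔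
        SteinitzRing.formCoeff n f (n - 1) ∈ (𝔞 : Ideal (𝓞 K)) ∧
          SteinitzRing.formCoeff n f n ∈ (𝔞 : Ideal (𝓞 K)) ^ 2)) ∧
    (SteinitzRing.formCoeff n f (n - 1) ∈ (𝔞 : Ideal (𝓞 K)) →
      SteinitzRing.formCoeff n f n ∈ (𝔞 : Ideal (𝓞 K)) ^ 2 →
      (∃! S : SteinitzRing.AlgebraStructure (𝓞 K) (SteinitzRing.extModule K n 𝔞),
          SteinitzRing.Extends S f) ∧
      (∀ c : ClassGroup (𝓞 K),
        SteinitzRing.IsSteinitzClass K n (SteinitzRing.extModule K n 𝔞) c ↔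
          c = ClassGroup.mk K (SteinitzRing.invIdeal K 𝔞)) ∧
      (∀ S : SteinitzRing.AlgebraStructure (𝓞 K) (SteinitzRing.extModule K n 𝔞),
        SteinitzRing.Extends S f →
          SteinitzRing.discIdeal K n S.mul =
            (((SteinitzRing.invIdeal K 𝔞 : FractionalIdeal (𝓞 K)⁰ K) ^ 2 :
                FractionalIdeal (𝓞 K)⁰ K) : Submodule (𝓞 K) K) *
              SteinitzRing.discIdeal K n (SteinitzRing.woodMul n f))) := by
  have hn0 : n ≠ 0 := by omega
  refine ⟨fun h0 => ⟨fun ⟨S, hS⟩ => hS.coeff_mem hn h0, fun ⟨h1, h2⟩ =>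
    ⟨_, SteinitzRing.extends_extStructure hn hf h1 h2⟩⟩, fun h1 h2 => ⟨?_, ?_, ?_⟩⟩
  · exact ⟨_, SteinitzRing.extends_extStructure hn hf h1 h2, fun T hT =>
      hT.unique (SteinitzRing.extends_extStructure hn hf h1 h2)⟩
  · exact SteinitzRing.isSteinitzClass_extModule_iff hn0 𝔞
  · exact fun S hS => hS.discIdeal_eq hn0
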